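/- Let $\alpha>-1$ and $\nu\ge 0$. Put $\rho_\nu(x)=2x^{\nu/2}K_\nu(2\sqrt x)$ for $x>0$, where $K_\nu$ is the modified Bessel function of the second kind, and $\rho_\nu(0)=\Gamma(\nu)$ if $\nu>0$. Let $T=[0,1]$ if $\nu>0$ and $T=(0,1]$ if $\nu=0$. For $t\in T$ let $$w_t(x)=x^{\alpha}e^{-(1-t)x}\rho_\nu(xt),\qquad x>0,$$ and let $P_n(x)=P_n(x;1-t,t)=a_nx^n+b_nx^{n-1}+\cdots$, $n=0,1,2,\dots$, be the orthonormal polynomials for this weight: $P_n$ has exact degree $n$ and $\int_0^\infty P_mP_n\,w_t\,dx=\delta_{m,n}$. The coefficients depend on $t$; the signs of the $P_n$ are chosen so that, for each $n$, the sign of $a_n=a_n(t)$ does not depend on $t\in T$ (for instance $a_n>0$). Put $P_{-1}=0$, $b_0=0$, $A_0=0$, $A_n=a_{n-1}/a_n$ for $n\ge1$, and $B_n=b_n/a_n-b_{n+1}/a_{n+1}$ for $n\ge 0$. Derivatives in $t$ are taken relative to $T$, hence are one-sided at the end points. Then: 1. All coefficients of all $P_n$ are differentiable functions of $t$ on $(0,1]$.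 2. For all $t\in T$, $n\ge0$ and $x\in\mathbb R$, $$\Big(t\frac{\partial}{\partial t}-x\frac{\partial}{\partial x}\Big)P_n(x;1-t,t)-\Big[\frac{t}{a_n}\frac{\partial a_n}{\partial t}-n\Big]P_n(x;1-t,t)+A_nP_{n-1}(x;1-t,t)=0,$$ where at $t=0$ the terms with the factor $t$ are read as $0$. 3. For all $t\in T$ and $n\ge 0$ the following derivatives exist and $$\frac{\partial}{\partial t}\Big(\frac{t\,b_n}{a_n}\Big)=-A_n^2,\qquad \frac{\partial}{\partial t}\big(tB_n\big)=A_{n+1}^2-A_n^2 .$$ 4. For all $t\in T$ the sequence $Q_n=\big(t\frac{\partial}{\partial t}-x\frac{\partial}{\partial x}\big)P_n(x;1-t,t)$, $n\ge0$ (again with $t\frac{\partial}{\partial t}$ read as $0$ at $t=0$), is quasi-orthogonal with respect to $w_t$: $Q_n$ is a polynomial in $x$ of degree at most $n$, $\int_0^\infty Q_n(x)x^m w_t(x)\,dx=0$ for $0\le m\le n-2$, and $\int_0^\infty Q_n(x)x^{n-1}w_t(x)\,dx\ne0$ for $n\ge1$. -/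

import Mathlib

open MeasureTheory Set Polynomial

noncomputable section

namespace PrudnikovLaguerre

/-- The modified Bessel function of the second kind (Macdonald function) `K_ν(z)` for real order
`ν` and real argument `z > 0`, by its standard integral
`K_ν(z) = ∫_0^∞ e^{-z cosh u} cosh (ν u) du`. -/
def besselK (ν z : ℝ) : ℝ :=
  ∫ u in Ioi (0 : ℝ), Real.exp (-(z * Real.cosh u)) * Real.cosh (ν * u)

/-- The scaled Macdonald function `ρ_ν(x) = 2 x^{ν/2} K_ν(2 √x)` for `x > 0`, with its value
`ρ_ν(0) = Γ(ν)` at the origin (the limit at `0` when `ν > 0`; not used when `ν = 0`). -/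
def rho (ν x : ℝ) : ℝ :=
  if x = 0 then Real.Gamma ν else 2 * x ^ (ν / 2) * besselK ν (2 * √x)

/-- The two-parameter weight `x^α e^{-l x} ρ_ν(x t)` on `(0, ∞)`. -/
def weight (α ν l t x : ℝ) : ℝ :=
  x ^ α * Real.exp (-(l * x)) * rho ν (x * t)

/-- `p 0, p 1, …` are orthonormal polynomials on `(0, ∞)` for the weight `w`: `p n` has exact
degree `n` and `∫ p_m p_n w = δ_{m,n}`. -/
def IsOrthonormalSeq (w : ℝ → ℝ) (p : ℕ → ℝ[X]) : Prop :=
  (∀ n, (p n).degree = n) ∧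
    ∀ m n, ∫ x in Ioi (0 : ℝ), (p m).eval x * (p n).eval x * w x = if m = n then 1 else 0

/-- The admissible parameters: `0 ≤ t ≤ 1`, where `t = 0` is allowed only if `ν > 0`
(for `ν = 0` the weight is infinite at `t = 0`). -/
def params (ν : ℝ) : Set ℝ := {t | 0 ≤ t ∧ t ≤ 1 ∧ (0 < t ∨ 0 < ν)}

/-- The leading coefficient `a_n` in `p_n = a_n x^n + b_n x^{n-1} + …`. -/
def aCoeff (p : ℕ → ℝ[X]) (n : ℕ) : ℝ := (p n).coeff n

/-- The subleading coefficient `b_n` in `p_n = a_n x^n + b_n x^{n-1} + …`, with `b_0 = 0`. -/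
def bCoeff (p : ℕ → ℝ[X]) : ℕ → ℝ
  | 0 => 0
  | n + 1 => (p (n + 1)).coeff n

/-- `A_n = a_{n-1} / a_n`, with `A_0 = 0` (from `p_{-1} = 0`). -/
def recA (p : ℕ → ℝ[X]) : ℕ → ℝ
  | 0 => 0
  | n + 1 => aCoeff p n / aCoeff p (n + 1)

/-- `B_n = b_n / a_n - b_{n+1} / a_{n+1}`. -/
def recB (p : ℕ → ℝ[X]) (n : ℕ) : ℝ :=
  bCoeff p n / aCoeff p n - bCoeff p (n + 1) / aCoeff p (n + 1)

/-- `(t ∂_t - x ∂_x) P_n` at `(x, t)`. The family is `P t n`, the parameter runs through `T`, and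
the derivative in `t` is one-sided at the end points of `T`. -/
def eulerOp (T : Set ℝ) (P : ℝ → ℕ → ℝ[X]) (n : ℕ) (t x : ℝ) : ℝ :=
  t * derivWithin (fun s => (P s n).eval x) T t - x * (derivative (P t n)).eval x

/-- The sequence `q 0, q 1, …` is quasi-orthogonal (of order one) on `(0, ∞)` for the weight `w`:
`q n` is a polynomial of degree at most `n` with `∫ q_n x^m w = 0` for `0 ≤ m ≤ n - 2` and,
if `n ≥ 1`, `∫ q_n x^{n-1} w ≠ 0`. -/
def IsQuasiOrthogonalSeq (w : ℝ → ℝ) (q : ℕ → ℝ → ℝ) : Prop :=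
  ∀ n, (∃ r : ℝ[X], r.natDegree ≤ n ∧ ∀ x, q n x = r.eval x) ∧
    (∀ m, m + 2 ≤ n → ∫ x in Ioi (0 : ℝ), q n x * x ^ m * w x = 0) ∧
    (1 ≤ n → ∫ x in Ioi (0 : ℝ), q n x * x ^ (n - 1) * w x ≠ 0)

end PrudnikovLaguerre

end

/-!
Writing `2 K_ν(2√x)` as an integral over `ℝ` and substituting `y = √x e^u` gives
`ρ_ν(x) = ∫ y^{ν-1} e^{-y-x/y} dy`, so the weight is a mixture of the exponentials
`e^{-(1-t+t/y)x}`, and by Tonelli its `k`-th moment is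
`μ_k(t) = Γ(s) ∫ e^{-y} y^{ν-1} (1-t+t/y)^{-s} dy` with `s = α + k + 1`. Differentiating under the
integral sign, `t μ_k' = μ_{k+1} - s μ_k`; at `t = 0` this is the recursion `Γ(s+1) = s Γ(s)`.

Hence, on differentiating `∫ P_n x^m w_t dx = 0` for `m < n`, the Euler operator
`E = t ∂_t - x ∂_x` shifts moments: `∫ (E P_n) x^m w_t dx = -∫ P_n x^{m+1} w_t dx`. Since
`E P_n` has degree at most `n`, these relations force it into the span of `P_n` and `P_{n-1}`, and
comparing the two highest coefficients gives the rest.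
-/

namespace PrudnikovLaguerre

/-! ### The weight as a mixture of exponentials -/

lemma mul_exp_image_univ {c : ℝ} (hc : 0 < c) :
    (fun u : ℝ => c * Real.exp u) '' univ = Ioi 0 := by
  ext y
  refine ⟨?_, fun hy => ⟨Real.log (y / c), mem_univ _, ?_⟩⟩
  · rintro ⟨u, -, rfl⟩
    exact mul_pos hc (Real.exp_pos u)
  · simp only [Real.exp_log (div_pos hy hc), mul_div_cancel₀ y hc.ne']

section ExpSubstitution

variable {E : Type*} [NormedAddCommGroup E] [NormedSpace ℝ E] {c : ℝ}

lemma setIntegral_Ioi_eq_integral_mul_exp (hc : 0 < c) (f : ℝ → E) :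
    ∫ y in Ioi (0 : ℝ), f y = ∫ u, (c * Real.exp u) • f (c * Real.exp u) := by
  have h := integral_image_eq_integral_abs_deriv_smul MeasurableSet.univ
    (fun u _ => ((Real.hasDerivAt_exp u).const_mul c).hasDerivWithinAt)
    ((mul_right_injective₀ hc.ne').comp Real.exp_injective).injOn f
  simpa only [mul_exp_image_univ hc, Measure.restrict_univ,
    abs_of_pos (mul_pos hc (Real.exp_pos _))] using h

lemma integrableOn_Ioi_iff_integrable_mul_exp (hc : 0 < c) (f : ℝ → E) :
    IntegrableOn f (Ioi 0) ↔ Integrable fun u => (c * Real.exp u) • f (c * Real.exp u) := by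
  have h := integrableOn_image_iff_integrableOn_abs_deriv_smul MeasurableSet.univ
    (fun u _ => ((Real.hasDerivAt_exp u).const_mul c).hasDerivWithinAt)
    ((mul_right_injective₀ hc.ne').comp Real.exp_injective).injOn f
  simpa only [mul_exp_image_univ hc, integrableOn_univ,
    abs_of_pos (mul_pos hc (Real.exp_pos _))] using h

end ExpSubstitution

/-- The integrand `y^{ν-1} e^{-y-x/y}` of the integral representation of `ρ_ν(x)`. -/
noncomputable def rhoKernel (ν x y : ℝ) : ℝ :=
  y ^ (ν - 1) * Real.exp (-(y + x / y))

lemma integrableOn_rhoKernel (ν : ℝ) {x : ℝ} (hx : 0 < x) :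
    IntegrableOn (rhoKernel ν x) (Ioi 0) := by
  obtain ⟨n, hn⟩ := exists_nat_gt (-ν)
  have hG := Real.GammaIntegral_convergent (neg_lt_iff_pos_add'.1 hn)
  refine (hG.const_mul (n.factorial * (x ^ n)⁻¹)).mono'
    (by unfold rhoKernel; fun_prop) ?_
  filter_upwards [ae_restrict_mem measurableSet_Ioi] with y (hy : 0 < y)
  have hexp : Real.exp (-(x / y)) ≤ n.factorial * (x ^ n)⁻¹ * y ^ n := by
    have h := Real.pow_div_factorial_le_exp (x / y) (by positivity) n
    rw [div_pow] at h
    rw [Real.exp_neg]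
    refine (inv_anti₀ (by positivity) h).trans_eq ?_
    field_simp
  rw [rhoKernel, Real.norm_of_nonneg (by positivity), neg_add, Real.exp_add,
    show ν + n - 1 = ν - 1 + n by ring, Real.rpow_add_natCast hy.ne']
  calc y ^ (ν - 1) * (Real.exp (-y) * Real.exp (-(x / y)))
      ≤ y ^ (ν - 1) * (Real.exp (-y) * (n.factorial * (x ^ n)⁻¹ * y ^ n)) := by gcongr
    _ = n.factorial * (x ^ n)⁻¹ * (Real.exp (-y) * (y ^ (ν - 1) * y ^ n)) := by ring

lemma rhoKernel_sqrt_mul_exp (ν : ℝ) {x : ℝ} (hx : 0 < x) (u : ℝ) :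
    (√x * Real.exp u) • rhoKernel ν x (√x * Real.exp u) =
      x ^ (ν / 2) * (Real.exp (-(2 * √x * Real.cosh u)) * Real.exp (ν * u)) := by
  have hs : 0 < √x := Real.sqrt_pos.2 hx
  have hy : 0 < √x * Real.exp u := mul_pos hs (Real.exp_pos u)
  have hpow : √x * Real.exp u * (√x * Real.exp u) ^ (ν - 1) =
      x ^ (ν / 2) * Real.exp (ν * u) := by
    rw [Real.rpow_sub_one hy.ne', mul_div_cancel₀ _ hy.ne',
      Real.mul_rpow hs.le (Real.exp_pos u).le, ← Real.exp_mul, Real.sqrt_eq_rpow,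
      ← Real.rpow_mul hx.le, one_div_mul_eq_div, mul_comm u]
  have hexp : √x * Real.exp u + x / (√x * Real.exp u) = 2 * √x * Real.cosh u := by
    rw [Real.cosh_eq, Real.exp_neg]
    field_simp
    rw [Real.sq_sqrt hx.le]
    ring
  rw [smul_eq_mul, rhoKernel, ← mul_assoc, hpow, hexp]
  ring

lemma two_mul_besselK {ν z : ℝ}
    (hint : Integrable fun u => Real.exp (-(z * Real.cosh u)) * Real.exp (ν * u)) :
    2 * besselK ν z = ∫ u, Real.exp (-(z * Real.cosh u)) * Real.exp (ν * u) := by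
  set f : ℝ → ℝ := fun u => Real.exp (-(z * Real.cosh u)) * Real.exp (ν * u) with hf
  have hcosh : ∀ u, Real.exp (-(z * Real.cosh u)) * Real.cosh (ν * u) = (f u + f (-u)) / 2 := by
    intro u
    simp only [hf, Real.cosh_neg, Real.cosh_eq (ν * u), mul_neg]
    ring
  have hneg : ∫ u in Ioi (0 : ℝ), f (-u) = ∫ u in Iic 0, f u := by
    rw [integral_comp_neg_Ioi, neg_zero]
  simp only [besselK, hcosh]
  rw [integral_div, integral_add hint.integrableOn hint.comp_neg.integrableOn, hneg, add_comm,
    intervalIntegral.integral_Iic_add_Ioi hint.integrableOn hint.integrableOn]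
  ring

lemma rho_eq_setIntegral_rhoKernel {ν x : ℝ} (hx : 0 ≤ x) (hxν : 0 < x ∨ 0 < ν) :
    rho ν x = ∫ y in Ioi (0 : ℝ), rhoKernel ν x y := by
  rcases hx.eq_or_lt with rfl | hx
  · simp only [rho, if_true, rhoKernel, zero_div, add_zero,
      Real.Gamma_eq_integral (hxν.resolve_left (lt_irrefl 0)), mul_comm]
  have hs : 0 < √x := Real.sqrt_pos.2 hx
  have hint := (integrableOn_Ioi_iff_integrable_mul_exp hs _).1 (integrableOn_rhoKernel ν hx)
  simp only [rhoKernel_sqrt_mul_exp ν hx] at hint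
  replace hint := (integrable_const_mul_iff (Real.rpow_pos_of_pos hx _).ne'.isUnit _).1 hint
  rw [setIntegral_Ioi_eq_integral_mul_exp hs]
  simp only [rhoKernel_sqrt_mul_exp ν hx]
  rw [integral_const_mul, ← two_mul_besselK hint, rho, if_neg hx.ne']
  ring

/-- The integrand `e^{-y} y^{ν-1} (1-t+t/y)^{-σ}`; up to the factor `Γ(σ)` its integral over
`(0, ∞)` is the mass of the weight with `σ = α + 1`. -/
noncomputable def massKernel (σ ν t y : ℝ) : ℝ :=
  Real.exp (-y) * y ^ (ν - 1) * (1 - t + t / y) ^ (-σ)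

/-- The total mass of the weight `x^α e^{-(1-t)x} ρ_ν(x t)`, as a function of `t`. -/
noncomputable def mass (α ν t : ℝ) : ℝ :=
  ∫ x in Ioi (0 : ℝ), weight α ν (1 - t) t x

section Mass

variable {α ν σ t y : ℝ}

lemma measurable_massKernel : Measurable (massKernel σ ν t) := by
  unfold massKernel
  fun_prop

lemma one_sub_add_div_pos (ht : t ∈ params ν) (hy : 0 < y) : 0 < 1 - t + t / y := by
  rcases ht.1.eq_or_lt with rfl | h0
  · norm_num
  · have := div_pos h0 hy
    linarith [ht.2.1]

lemma massKernel_nonneg (ht : t ∈ params ν) (hy : 0 < y) : 0 ≤ massKernel σ ν t y := by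
  have := one_sub_add_div_pos ht hy
  unfold massKernel
  positivity

lemma massKernel_zero : massKernel σ ν 0 y = Real.exp (-y) * y ^ (ν - 1) := by
  simp [massKernel]

lemma massKernel_le (hσ : 0 ≤ σ) {r : ℝ} (hr : 0 < r) (hrt : r ≤ t) (ht : t ≤ 1) (hy : 0 < y) :
    massKernel σ ν t y ≤ r ^ (-σ) * (Real.exp (-y) * y ^ (ν + σ - 1)) := by
  have hrate : r / y ≤ 1 - t + t / y := by
    have : r / y ≤ t / y := by gcongr
    linarith
  calc massKernel σ ν t y
      ≤ Real.exp (-y) * y ^ (ν - 1) * (r / y) ^ (-σ) :=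
        mul_le_mul_of_nonneg_left
          (Real.rpow_le_rpow_of_nonpos (div_pos hr hy) hrate (neg_nonpos.2 hσ)) (by positivity)
    _ = r ^ (-σ) * (Real.exp (-y) * y ^ (ν + σ - 1)) := by
        rw [Real.div_rpow hr.le hy.le, Real.rpow_neg hy.le, div_inv_eq_mul,
          show ν + σ - 1 = ν - 1 + σ by ring, Real.rpow_add hy]
        ring

lemma integrableOn_massKernel (hσ : 0 ≤ σ) (hνσ : 0 < ν + σ) (ht : t ∈ params ν) :
    IntegrableOn (massKernel σ ν t) (Ioi 0) := by
  rcases ht.1.eq_or_lt with rfl | h0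
  · simpa only [funext fun y => massKernel_zero (σ := σ) (ν := ν) (y := y)] using
      Real.GammaIntegral_convergent (ht.2.2.resolve_left (lt_irrefl 0))
  · refine ((Real.GammaIntegral_convergent hνσ).const_mul (t ^ (-σ))).mono'
      measurable_massKernel.aestronglyMeasurable ?_
    filter_upwards [ae_restrict_mem measurableSet_Ioi] with y hy
    rw [Real.norm_of_nonneg (massKernel_nonneg ht hy)]
    exact massKernel_le hσ h0 le_rfl ht.2.1 hy

/-- The weight as a function of `x`, before the integration over the mixing variable `y`. -/
noncomputable def weightKernel (α ν t x y : ℝ) : ℝ :=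
  x ^ α * Real.exp (-((1 - t) * x)) * rhoKernel ν (x * t) y

lemma setIntegral_weightKernel_right (ht : t ∈ params ν) {x : ℝ} (hx : 0 < x) :
    ∫ y in Ioi (0 : ℝ), weightKernel α ν t x y = weight α ν (1 - t) t x := by
  have hxν : 0 < x * t ∨ 0 < ν := ht.2.2.imp_left (mul_pos hx)
  rw [weight, rho_eq_setIntegral_rhoKernel (mul_nonneg hx.le ht.1) hxν, ← integral_const_mul]
  rfl

lemma weightKernel_nonneg {x : ℝ} (hx : 0 < x) (hy : 0 < y) : 0 ≤ weightKernel α ν t x y := by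
  unfold weightKernel rhoKernel
  positivity

lemma weightKernel_eq (x : ℝ) : weightKernel α ν t x y =
    Real.exp (-y) * y ^ (ν - 1) *
      (x ^ (α + 1 - 1) * Real.exp (-((1 - t + t / y) * x))) := by
  have hexp : Real.exp (-((1 - t) * x)) * Real.exp (-(y + x * t / y)) =
      Real.exp (-y) * Real.exp (-((1 - t + t / y) * x)) := by
    rw [← Real.exp_add, ← Real.exp_add]
    ring_nf
  rw [weightKernel, rhoKernel, add_sub_cancel_right]
  linear_combination x ^ α * y ^ (ν - 1) * hexp

lemma setIntegral_weightKernel_left (hα : -1 < α) (ht : t ∈ params ν) (hy : 0 < y) :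
    ∫ x in Ioi (0 : ℝ), weightKernel α ν t x y =
      Real.Gamma (α + 1) * massKernel (α + 1) ν t y := by
  have hr := one_sub_add_div_pos ht hy
  simp only [weightKernel_eq]
  rw [integral_const_mul, Real.integral_rpow_mul_exp_neg_mul_Ioi (neg_lt_iff_pos_add.1 hα) hr,
    one_div, Real.inv_rpow hr.le, ← Real.rpow_neg hr.le, massKernel]
  ring

lemma integrableOn_weightKernel_left (hα : -1 < α) (ht : t ∈ params ν) (hy : 0 < y) :
    IntegrableOn (fun x => weightKernel α ν t x y) (Ioi 0) := by
  have hα' : 0 < α + 1 := by linarith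
  have hr := one_sub_add_div_pos ht hy
  refine .of_integral_ne_zero ?_
  rw [setIntegral_weightKernel_left hα ht hy, massKernel]
  have := Real.Gamma_pos_of_pos hα'
  positivity

lemma integrable_weightKernel (hα : -1 < α) (hαν : -1 < α + ν) (ht : t ∈ params ν) :
    Integrable (Function.uncurry (weightKernel α ν t))
      ((volume.restrict (Ioi 0)).prod (volume.restrict (Ioi 0))) := by
  have hmeas : Measurable (Function.uncurry (weightKernel α ν t)) := by
    unfold Function.uncurry weightKernel rhoKernel
    fun_prop
  refine (integrable_prod_iff' hmeas.aestronglyMeasurable).2 ⟨?_, ?_⟩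
  · filter_upwards [ae_restrict_mem measurableSet_Ioi] with y hy
    exact integrableOn_weightKernel_left hα ht hy
  · refine IntegrableOn.congr_fun (f := fun y => Real.Gamma (α + 1) * massKernel (α + 1) ν t y)
      ((integrableOn_massKernel (by linarith) (by linarith) ht).const_mul _)
      (fun y hy => ?_) measurableSet_Ioi
    refine (setIntegral_weightKernel_left hα ht hy).symm.trans ?_
    exact setIntegral_congr_fun measurableSet_Ioi fun x hx =>
      (Real.norm_of_nonneg (weightKernel_nonneg hx hy)).symm

lemma integrableOn_weight (hα : -1 < α) (hαν : -1 < α + ν) (ht : t ∈ params ν) :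
    IntegrableOn (weight α ν (1 - t) t) (Ioi 0) :=
  IntegrableOn.congr_fun (integrable_weightKernel hα hαν ht).integral_prod_left
    (fun _ hx => setIntegral_weightKernel_right ht hx) measurableSet_Ioi

lemma mass_eq_Gamma_mul (hα : -1 < α) (hαν : -1 < α + ν) (ht : t ∈ params ν) :
    mass α ν t = Real.Gamma (α + 1) * ∫ y in Ioi (0 : ℝ), massKernel (α + 1) ν t y :=
  calc mass α ν t
      = ∫ x in Ioi (0 : ℝ), ∫ y in Ioi (0 : ℝ), weightKernel α ν t x y :=
        setIntegral_congr_fun measurableSet_Ioi fun _ hx =>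
          (setIntegral_weightKernel_right ht hx).symm
    _ = ∫ y in Ioi (0 : ℝ), ∫ x in Ioi (0 : ℝ), weightKernel α ν t x y :=
        integral_integral_swap (integrable_weightKernel hα hαν ht)
    _ = ∫ y in Ioi (0 : ℝ), Real.Gamma (α + 1) * massKernel (α + 1) ν t y :=
        setIntegral_congr_fun measurableSet_Ioi fun _ hy =>
          setIntegral_weightKernel_left hα ht hy
    _ = _ := integral_const_mul _ _

lemma pow_mul_weight {l x : ℝ} (k : ℕ) (hx : 0 < x) :
    x ^ k * weight α ν l t x = weight (α + k) ν l t x := by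
  rw [weight, weight, Real.rpow_add_natCast hx.ne']
  ring

lemma integrableOn_pow_mul_weight (hα : -1 < α) (hαν : -1 < α + ν) (ht : t ∈ params ν) (k : ℕ) :
    IntegrableOn (fun x => x ^ k * weight α ν (1 - t) t x) (Ioi 0) :=
  (integrableOn_weight (by linarith [k.cast_nonneg (α := ℝ)])
    (by linarith [k.cast_nonneg (α := ℝ)]) ht).congr_fun
    (fun _ hx => (pow_mul_weight k hx).symm) measurableSet_Ioi

lemma setIntegral_pow_mul_weight (k : ℕ) :
    ∫ x in Ioi (0 : ℝ), x ^ k * weight α ν (1 - t) t x = mass (α + k) ν t :=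
  setIntegral_congr_fun measurableSet_Ioi fun _ hx => pow_mul_weight k hx

end Mass

/-! ### The derivative of the mass in the parameter -/

lemma hasDerivWithinAt_integral_of_dominated {X E : Type*} [MeasurableSpace X]
    [NormedAddCommGroup E] [NormedSpace ℝ E] {m : Measure X} {F F' : ℝ → X → E} {S : Set ℝ}
    {t : ℝ} {bound : X → ℝ} (hS : Convex ℝ S) (ht : t ∈ S)
    (hF : ∀ s ∈ S, Integrable (F s) m)
    (hF' : ∀ᵐ x ∂m, ∀ s ∈ S, HasDerivWithinAt (fun s => F s x) (F' s x) S s)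
    (hle : ∀ᵐ x ∂m, ∀ s ∈ S, ‖F' s x‖ ≤ bound x) (hbound : Integrable bound m) :
    HasDerivWithinAt (fun s => ∫ x, F s x ∂m) (∫ x, F' t x ∂m) S t := by
  rw [hasDerivWithinAt_iff_tendsto_slope]
  have hmem : ∀ᶠ s in nhdsWithin t (S \ {t}), s ∈ S \ {t} := self_mem_nhdsWithin
  have hslope : ∀ s ∈ S, ∫ x, slope (fun s => F s x) t s ∂m =
      slope (fun s => ∫ x, F s x ∂m) t s := fun s hs => by
    simp only [slope_def_module, integral_smul, integral_sub (hF s hs) (hF t ht)]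
  refine (tendsto_integral_filter_of_dominated_convergence bound ?_ ?_ hbound ?_).congr'
    (hmem.mono fun s hs => hslope s hs.1)
  · filter_upwards [hmem] with s hs
    simp only [slope_def_module]
    exact (((hF s hs.1).sub (hF t ht)).aestronglyMeasurable.const_smul _)
  · filter_upwards [hmem] with s hs
    filter_upwards [hF', hle] with x hx hxle
    have hpos : 0 < ‖s - t‖ := norm_pos_iff.2 (sub_ne_zero.2 hs.2)
    rw [slope_def_module, norm_smul, norm_inv, inv_mul_le_iff₀ hpos, mul_comm]
    exact hS.norm_image_sub_le_of_norm_hasDerivWithin_le hx hxle ht hs.1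
  · filter_upwards [hF'] with x hx
    exact hasDerivWithinAt_iff_tendsto_slope.1 (hx t ht)

section MassDeriv

variable {α ν σ t y : ℝ}

lemma hasDerivAt_massKernel (h0 : 0 < t) (ht : t ≤ 1) (hy : 0 < y) :
    HasDerivAt (fun s => massKernel σ ν s y)
      (σ / t * (massKernel (σ + 1) ν t y - massKernel σ ν t y)) t := by
  have hr : 0 < 1 - t + t / y := one_sub_add_div_pos (ν := ν) ⟨h0.le, ht, .inl h0⟩ hy
  -- `t (1 / y - 1) = (1 - t + t / y) - 1` trades the `t`-derivative for a shift of `σ`.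
  have hlin : HasDerivAt (fun s => 1 - s + s / y) (-1 + 1 / y) t :=
    ((hasDerivAt_id t).const_sub 1).add ((hasDerivAt_id t).div_const y)
  refine ((hlin.rpow_const (p := -σ) (.inl hr.ne')).const_mul
    (Real.exp (-y) * y ^ (ν - 1))).congr_deriv ?_
  have hpow : (1 - t + t / y) ^ (-σ) = (1 - t + t / y) ^ (-σ - 1) * (1 - t + t / y) := by
    rw [← Real.rpow_add_one hr.ne', sub_add_cancel]
  rw [massKernel, massKernel, hpow, neg_add']
  field_simp
  ring

lemma Ioc_subset_params : Ioc 0 1 ⊆ params ν :=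
  fun _ ht => ⟨ht.1.le, ht.2, .inl ht.1⟩

lemma hasDerivWithinAt_integral_massKernel (hσ : 0 ≤ σ) (hνσ : 0 < ν + σ) (h0 : 0 < t)
    (ht : t ≤ 1) :
    HasDerivWithinAt (fun s => ∫ y in Ioi (0 : ℝ), massKernel σ ν s y)
      (∫ y in Ioi (0 : ℝ), σ / t * (massKernel (σ + 1) ν t y - massKernel σ ν t y))
      (Icc (t / 2) 1) t := by
  have h2 : 0 < t / 2 := half_pos h0
  have hpos : ∀ s ∈ Icc (t / 2) 1, 0 < s := fun s hs => h2.trans_le hs.1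
  have hsub : ∀ s ∈ Icc (t / 2) 1, s ∈ params ν := fun s hs =>
    Ioc_subset_params ⟨hpos s hs, hs.2⟩
  have hνσ' : 0 < ν + (σ + 1) := by linarith
  refine hasDerivWithinAt_integral_of_dominated
    (F' := fun s y => σ / s * (massKernel (σ + 1) ν s y - massKernel σ ν s y))
    (bound := fun y => σ / (t / 2) *
      ((t / 2) ^ (-(σ + 1)) * (Real.exp (-y) * y ^ (ν + (σ + 1) - 1)) +
        (t / 2) ^ (-σ) * (Real.exp (-y) * y ^ (ν + σ - 1))))
    (convex_Icc _ _) ⟨(half_lt_self h0).le, ht⟩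
    (fun s hs => integrableOn_massKernel hσ hνσ (hsub s hs)) ?_ ?_
    ((((Real.GammaIntegral_convergent hνσ').const_mul _).add
      ((Real.GammaIntegral_convergent hνσ).const_mul _)).const_mul _)
  · filter_upwards [ae_restrict_mem measurableSet_Ioi] with y hy s hs
    exact (hasDerivAt_massKernel (hpos s hs) hs.2 hy).hasDerivWithinAt
  · filter_upwards [ae_restrict_mem measurableSet_Ioi] with y (hy : 0 < y) s hs
    have hle₀ := massKernel_le (ν := ν) hσ h2 hs.1 hs.2 hy
    have hle₁ := massKernel_le (ν := ν) (add_nonneg hσ zero_le_one) h2 hs.1 hs.2 hy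
    have hn₀ := massKernel_nonneg (σ := σ) (hsub s hs) hy
    have hn₁ := massKernel_nonneg (σ := σ + 1) (hsub s hs) hy
    rw [norm_mul, Real.norm_of_nonneg (div_nonneg hσ (hpos s hs).le)]
    refine mul_le_mul (div_le_div_of_nonneg_left hσ h2 hs.1) ?_ (norm_nonneg _)
      (div_nonneg hσ h2.le)
    refine (norm_sub_le _ _).trans ?_
    rw [Real.norm_of_nonneg hn₀, Real.norm_of_nonneg hn₁]
    exact add_le_add hle₁ hle₀

lemma hasDerivWithinAt_mass (hα : -1 < α) (hαν : -1 < α + ν) (h0 : 0 < t) (ht : t ≤ 1) :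
    HasDerivWithinAt (mass α ν) ((mass (α + 1) ν t - (α + 1) * mass α ν t) / t)
      (params ν) t := by
  have hσ : 0 < α + 1 := by linarith
  have hνσ : 0 < ν + (α + 1) := by linarith
  have htp : t ∈ params ν := Ioc_subset_params ⟨h0, ht⟩
  have hnhds : Icc (t / 2) 1 ∈ nhdsWithin t (params ν) :=
    Filter.mem_of_superset
      (inter_mem_nhdsWithin _ (Ici_mem_nhds (half_lt_self h0))) fun s hs => ⟨hs.2, hs.1.2.1⟩
  have hderiv := (((hasDerivWithinAt_integral_massKernel hσ.le hνσ h0 ht).mono_of_mem_nhdsWithin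
    hnhds).const_mul (Real.Gamma (α + 1))).congr_of_mem
    (fun s hs => mass_eq_Gamma_mul hα hαν hs) htp
  refine hderiv.congr_deriv ?_
  rw [integral_const_mul, integral_sub (integrableOn_massKernel (by linarith) (by linarith) htp)
    (integrableOn_massKernel hσ.le hνσ htp), mass_eq_Gamma_mul hα hαν htp,
    mass_eq_Gamma_mul (α := α + 1) (by linarith) (by linarith) htp, Real.Gamma_add_one hσ.ne']
  ring

lemma continuousWithinAt_mass_zero (hα : -1 < α) (h0 : 0 ∈ params ν) :
    ContinuousWithinAt (mass α ν) (params ν) 0 := by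
  have hν : 0 < ν := h0.2.2.resolve_left (lt_irrefl 0)
  have hcont : ContinuousWithinAt (fun s => ∫ y in Ioi (0 : ℝ), massKernel (α + 1) ν s y)
      (params ν) 0 := by
    refine continuousWithinAt_of_dominated
      (bound := fun y => (1 / 2) ^ (-(α + 1)) * (Real.exp (-y) * y ^ (ν - 1)))
      (.of_forall fun s => measurable_massKernel.aestronglyMeasurable) ?_
      ((Real.GammaIntegral_convergent hν).const_mul _) ?_
    · filter_upwards [inter_mem_nhdsWithin _ (Iic_mem_nhds one_half_pos)] with s hs
      filter_upwards [ae_restrict_mem measurableSet_Ioi] with y (hy : 0 < y)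
      have hrate : (1 : ℝ) / 2 ≤ 1 - s + s / y := by
        have := div_nonneg hs.1.1 hy.le
        have : s ≤ 1 / 2 := hs.2
        linarith
      rw [Real.norm_of_nonneg (massKernel_nonneg hs.1 hy), massKernel, mul_comm]
      exact mul_le_mul_of_nonneg_right
        (Real.rpow_le_rpow_of_nonpos one_half_pos hrate (by linarith)) (by positivity)
    · filter_upwards [ae_restrict_mem measurableSet_Ioi] with y hy
      refine ContinuousAt.continuousWithinAt (ContinuousAt.mul continuousAt_const ?_)
      exact ContinuousAt.rpow_const (by fun_prop) (.inl (one_sub_add_div_pos h0 hy).ne')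
  exact (hcont.const_mul (Real.Gamma (α + 1))).congr
    (fun s hs => mass_eq_Gamma_mul hα (by linarith) hs) (mass_eq_Gamma_mul hα (by linarith) h0)

lemma mass_add_one_zero (hα : -1 < α) (h0 : 0 ∈ params ν) :
    mass (α + 1) ν 0 = (α + 1) * mass α ν 0 := by
  have hν : 0 < ν := h0.2.2.resolve_left (lt_irrefl 0)
  rw [mass_eq_Gamma_mul (by linarith) (by linarith) h0, mass_eq_Gamma_mul hα (by linarith) h0,
    Real.Gamma_add_one (by linarith)]
  simp only [massKernel_zero]
  ring

end MassDeriv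

/-! ### Euler differentiability -/

/-- `t ∂_t f` makes sense at `t`: `f` is differentiable at `t` if `t ≠ 0`, and merely continuous at
`t = 0`, where `t * derivWithin f T t` is `0`, as it should be. -/
def EulerDifferentiableWithinAt (f : ℝ → ℝ) (T : Set ℝ) (t : ℝ) : Prop :=
  ContinuousWithinAt f T t ∧ (t ≠ 0 → DifferentiableWithinAt ℝ f T t)

namespace EulerDifferentiableWithinAt

variable {f g : ℝ → ℝ} {T : Set ℝ} {t : ℝ}

lemma const (c : ℝ) : EulerDifferentiableWithinAt (fun _ => c) T t :=
  ⟨continuousWithinAt_const, fun _ => differentiableWithinAt_const c⟩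

lemma sub (hf : EulerDifferentiableWithinAt f T t) (hg : EulerDifferentiableWithinAt g T t) :
    EulerDifferentiableWithinAt (fun s => f s - g s) T t :=
  ⟨hf.1.sub hg.1, fun h0 => (hf.2 h0).fun_sub (hg.2 h0)⟩

lemma mul (hf : EulerDifferentiableWithinAt f T t) (hg : EulerDifferentiableWithinAt g T t) :
    EulerDifferentiableWithinAt (fun s => f s * g s) T t :=
  ⟨hf.1.mul hg.1, fun h0 => (hf.2 h0).fun_mul (hg.2 h0)⟩

lemma sum {ι : Type*} {I : Finset ι} {F : ι → ℝ → ℝ}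
    (hF : ∀ i ∈ I, EulerDifferentiableWithinAt (F i) T t) :
    EulerDifferentiableWithinAt (fun s => ∑ i ∈ I, F i s) T t :=
  ⟨tendsto_finsetSum I fun i hi => (hF i hi).1,
    fun h0 => DifferentiableWithinAt.fun_sum fun i hi => (hF i hi).2 h0⟩

lemma inv (hf : EulerDifferentiableWithinAt f T t) (ht : f t ≠ 0) :
    EulerDifferentiableWithinAt (fun s => (f s)⁻¹) T t :=
  ⟨hf.1.inv₀ ht, fun h0 => (hf.2 h0).fun_inv ht⟩

lemma div (hf : EulerDifferentiableWithinAt f T t) (hg : EulerDifferentiableWithinAt g T t)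
    (ht : g t ≠ 0) : EulerDifferentiableWithinAt (fun s => f s / g s) T t := by
  simpa only [div_eq_mul_inv] using hf.mul (hg.inv ht)

lemma sqrt (hf : EulerDifferentiableWithinAt f T t) (ht : f t ≠ 0) :
    EulerDifferentiableWithinAt (fun s => √(f s)) T t :=
  ⟨hf.1.sqrt, fun h0 => (hf.2 h0).sqrt ht⟩

lemma congr (hf : EulerDifferentiableWithinAt f T t) (h : EqOn g f T) (ht : t ∈ T) :
    EulerDifferentiableWithinAt g T t :=
  ⟨hf.1.congr h (h ht), fun h0 => (hf.2 h0).congr h (h ht)⟩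

lemma mul_derivWithin_mul (hf : EulerDifferentiableWithinAt f T t)
    (hg : EulerDifferentiableWithinAt g T t) :
    t * derivWithin (fun s => f s * g s) T t =
      t * derivWithin f T t * g t + f t * (t * derivWithin g T t) := by
  rcases eq_or_ne t 0 with rfl | h0
  · simp only [zero_mul, mul_zero, add_zero]
  · rw [derivWithin_fun_mul (hf.2 h0) (hg.2 h0)]
    ring

lemma mul_derivWithin_div (hf : EulerDifferentiableWithinAt f T t)
    (hg : EulerDifferentiableWithinAt g T t) (ht : g t ≠ 0) :
    t * derivWithin (fun s => f s / g s) T t =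
      (t * derivWithin f T t * g t - f t * (t * derivWithin g T t)) / g t ^ 2 := by
  rcases eq_or_ne t 0 with rfl | h0
  · simp only [zero_mul, mul_zero, sub_zero, zero_div]
  · rw [derivWithin_fun_div (hf.2 h0) (hg.2 h0) ht]
    ring

lemma mul_derivWithin_sum {ι : Type*} {I : Finset ι} {F : ι → ℝ → ℝ}
    (hF : ∀ i ∈ I, EulerDifferentiableWithinAt (F i) T t) :
    t * derivWithin (fun s => ∑ i ∈ I, F i s) T t = ∑ i ∈ I, t * derivWithin (F i) T t := by
  rcases eq_or_ne t 0 with rfl | h0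
  · simp only [zero_mul, Finset.sum_const_zero]
  · rw [derivWithin_fun_sum fun i hi => (hF i hi).2 h0, Finset.mul_sum]

lemma hasDerivWithinAt_id_mul (hf : EulerDifferentiableWithinAt f T t) :
    HasDerivWithinAt (fun s => s * f s) (f t + t * derivWithin f T t) T t := by
  rcases eq_or_ne t 0 with rfl | h0
  · rw [zero_mul, add_zero, hasDerivWithinAt_iff_tendsto_slope]
    refine (hf.1.mono sdiff_subset).tendsto.congr' ?_
    filter_upwards [self_mem_nhdsWithin] with s hs
    rw [slope_def_field, zero_mul, sub_zero, sub_zero, mul_div_cancel_left₀ _ hs.2]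
  · exact ((hasDerivWithinAt_id t T).fun_mul (hf.2 h0).hasDerivWithinAt).congr_deriv (by simp)

end EulerDifferentiableWithinAt

/-! ### Moment functionals and orthonormal polynomials -/

/-- The linear functional on polynomials whose value at `X ^ k` is `μ k`. -/
noncomputable def momentFunctional {R : Type*} [CommSemiring R] (μ : ℕ → R) : R[X] →ₗ[R] R :=
  Polynomial.lsum fun k => μ k • LinearMap.id

section MomentFunctional

variable {R : Type*} [CommSemiring R]

lemma momentFunctional_X_pow (μ : ℕ → R) (k : ℕ) : momentFunctional μ (X ^ k) = μ k := by
  rw [momentFunctional, Polynomial.lsum_apply, ← monomial_one_right_eq_X_pow,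
    sum_monomial_index 1 _ (by rw [map_zero])]
  simp only [LinearMap.smul_apply, LinearMap.id_apply, smul_eq_mul, mul_one]

lemma momentFunctional_mul_X_pow (μ : ℕ → R) {q : R[X]} {N : ℕ} (hq : q.natDegree ≤ N) (m : ℕ) :
    momentFunctional μ (q * X ^ m) = ∑ k ∈ Finset.range (N + 1), q.coeff k * μ (k + m) := by
  conv_lhs => rw [q.as_sum_range_C_mul_X_pow' (Nat.lt_succ_of_le hq)]
  simp only [Finset.sum_mul, map_sum, ← smul_eq_C_mul, smul_mul_assoc, ← pow_add, map_smul,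
    momentFunctional_X_pow, smul_eq_mul]

lemma map_mul_eq_of_map_mul_X_pow_eq {L : R[X] →ₗ[R] R} {n : ℕ} {q₁ q₂ r : R[X]}
    (hL : ∀ m < n, L (q₁ * X ^ m) = L (q₂ * X ^ m)) (hr : r.natDegree < n) :
    L (q₁ * r) = L (q₂ * r) := by
  rw [r.as_sum_range_C_mul_X_pow' hr]
  simp only [Finset.mul_sum, map_sum, ← smul_eq_C_mul, mul_smul_comm, map_smul]
  exact Finset.sum_congr rfl fun m hm => by rw [hL m (Finset.mem_range.1 hm)]

lemma setIntegral_eval_mul_eq_momentFunctional {A : Set ℝ} {w : ℝ → ℝ}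
    (hw : ∀ k : ℕ, IntegrableOn (fun x => x ^ k * w x) A) (q : ℝ[X]) :
    ∫ x in A, q.eval x * w x = momentFunctional (fun k => ∫ x in A, x ^ k * w x) q := by
  have h := momentFunctional_mul_X_pow (fun k => ∫ x in A, x ^ k * w x) le_rfl (q := q) 0
  simp only [pow_zero, mul_one, add_zero, ← integral_const_mul] at h
  rw [h, ← integral_finsetSum _ fun k _ => (hw k).const_mul (q.coeff k)]
  simp only [eval_eq_sum_range, Finset.sum_mul, mul_assoc]

end MomentFunctional

/-- `p 0, p 1, …` are orthonormal polynomials, `p n` of exact degree `n`, for the linear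
functional `L`. -/
def IsOrthonormalFor {𝕜 : Type*} [Field 𝕜] (L : 𝕜[X] →ₗ[𝕜] 𝕜) (p : ℕ → 𝕜[X]) : Prop :=
  (∀ n, (p n).degree = n) ∧ ∀ m n, L (p m * p n) = if m = n then 1 else 0

lemma IsOrthonormalSeq.isOrthonormalFor {w : ℝ → ℝ} {p : ℕ → ℝ[X]}
    (hp : IsOrthonormalSeq w p)
    (hw : ∀ k : ℕ, IntegrableOn (fun x => x ^ k * w x) (Ioi 0)) :
    IsOrthonormalFor (momentFunctional fun k => ∫ x in Ioi (0 : ℝ), x ^ k * w x) p :=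
  ⟨hp.1, fun m n => by
    simpa only [← setIntegral_eval_mul_eq_momentFunctional hw, eval_mul] using hp.2 m n⟩

namespace IsOrthonormalFor

variable {𝕜 : Type*} [Field 𝕜] {L : 𝕜[X] →ₗ[𝕜] 𝕜} {p : ℕ → 𝕜[X]}

lemma natDegree_eq (h : IsOrthonormalFor L p) (n : ℕ) : (p n).natDegree = n :=
  natDegree_eq_of_degree_eq_some (h.1 n)

lemma coeff_self_ne_zero (h : IsOrthonormalFor L p) (n : ℕ) : (p n).coeff n ≠ 0 :=
  coeff_ne_zero_of_eq_degree (h.1 n)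

lemma coeff_eq_zero_of_lt (h : IsOrthonormalFor L p) {m n : ℕ} (hmn : m < n) :
    (p m).coeff n = 0 :=
  coeff_eq_zero_of_natDegree_lt ((h.natDegree_eq m).trans_lt hmn)

lemma eq_sum_of_degree_lt (h : IsOrthonormalFor L p) {n : ℕ} {q : 𝕜[X]} (hq : q.degree < n) :
    q = ∑ j ∈ Finset.range n, L (p j * q) • p j := by
  let S : Polynomial.Sequence 𝕜 := ⟨p, h.1⟩
  have hspan : q ∈ Submodule.span 𝕜 (S '' Iio n) := by
    rw [S.span_degreeLT fun i _ => (leadingCoeff_ne_zero.2 (S.ne_zero i)).isUnit]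
    exact mem_degreeLT.2 hq
  clear hq
  induction hspan using Submodule.span_induction with
  | mem x hx =>
    obtain ⟨i, hi, rfl⟩ := hx
    change p i = ∑ j ∈ Finset.range n, L (p j * p i) • p j
    simp only [h.2, ite_smul, one_smul, zero_smul, Finset.sum_ite_eq', Finset.mem_range,
      if_pos (mem_Iio.1 hi)]
  | zero => simp only [mul_zero, map_zero, zero_smul, Finset.sum_const_zero]
  | add x y _ _ hx hy =>
    simp only [mul_add, map_add, add_smul, Finset.sum_add_distrib]
    rw [← hx, ← hy]
  | smul c x _ hx =>
    simp only [mul_smul_comm, map_smul, smul_assoc, ← Finset.smul_sum]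
    rw [← hx]

lemma map_mul_eq_coeff_div (h : IsOrthonormalFor L p) {n : ℕ} {q : 𝕜[X]} (hq : q.natDegree ≤ n) :
    L (p n * q) = q.coeff n / (p n).coeff n := by
  have hsum := h.eq_sum_of_degree_lt (n := n + 1) (q := q)
    ((natDegree_le_iff_degree_le.1 hq).trans_lt (by exact_mod_cast n.lt_succ_self))
  have hcoeff := congrArg (coeff · n) hsum
  simp only [finsetSum_coeff, coeff_smul, smul_eq_mul] at hcoeff
  rw [Finset.sum_range_succ, Finset.sum_eq_zero fun j hj => by
    rw [h.coeff_eq_zero_of_lt (Finset.mem_range.1 hj), mul_zero], zero_add] at hcoeff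
  rw [hcoeff, mul_div_cancel_right₀ _ (h.coeff_self_ne_zero n)]

lemma map_mul_X_pow_of_lt (h : IsOrthonormalFor L p) {m n : ℕ} (hm : m < n) :
    L (p n * X ^ m) = 0 := by
  rw [h.map_mul_eq_coeff_div ((natDegree_X_pow_le m).trans hm.le), coeff_X_pow, if_neg hm.ne',
    zero_div]

lemma map_mul_X_pow_self (h : IsOrthonormalFor L p) (n : ℕ) :
    L (p n * X ^ n) = ((p n).coeff n)⁻¹ := by
  rw [h.map_mul_eq_coeff_div (natDegree_X_pow_le n), coeff_X_pow_self, one_div]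

lemma X_pow_eq_sum (h : IsOrthonormalFor L p) (n : ℕ) :
    (X ^ n : 𝕜[X]) =
      ∑ j ∈ Finset.range n, L (p j * X ^ n) • p j + ((p n).coeff n)⁻¹ • p n := by
  conv_lhs => rw [h.eq_sum_of_degree_lt (n := n + 1)
    ((degree_X_pow_le n).trans_lt (by exact_mod_cast n.lt_succ_self)), Finset.sum_range_succ,
    h.map_mul_X_pow_self]

lemma eq_gramSchmidt (h : IsOrthonormalFor L p) (n : ℕ) :
    p n = (p n).coeff n • (X ^ n - ∑ j ∈ Finset.range n, L (p j * X ^ n) • p j) := by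
  conv_rhs => rw [sub_eq_of_eq_add' (h.X_pow_eq_sum n),
    smul_inv_smul₀ (h.coeff_self_ne_zero n)]

lemma inv_sq_coeff_self_eq (h : IsOrthonormalFor L p) (n : ℕ) :
    ((p n).coeff n ^ 2)⁻¹ =
      L (X ^ (n + n)) - ∑ j ∈ Finset.range n, L (p j * X ^ n) ^ 2 := by
  have hL := congrArg (fun q => L (q * X ^ n)) (h.X_pow_eq_sum n)
  simp only [add_mul, Finset.sum_mul, smul_mul_assoc, map_add, map_sum, map_smul, smul_eq_mul,
    h.map_mul_X_pow_self, ← pow_add] at hL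
  simp only [hL, ← sq, add_sub_cancel_left, inv_pow]

lemma eq_add_of_map_mul_X_pow_succ (h : IsOrthonormalFor L p) {n : ℕ} {q : 𝕜[X]}
    (hq : q.natDegree ≤ n + 1)
    (hL : ∀ m < n + 1, L (q * X ^ m) = -L (p (n + 1) * X ^ (m + 1))) :
    q = (q.coeff (n + 1) / (p (n + 1)).coeff (n + 1)) • p (n + 1) -
      ((p n).coeff n / (p (n + 1)).coeff (n + 1)) • p n := by
  have hcoeff : ∀ j < n + 1, L (p j * q) = -((p j).coeff n / (p (n + 1)).coeff (n + 1)) := by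
    intro j hj
    have hshift : L (q * p j) = L (-(p (n + 1) * X) * p j) :=
      map_mul_eq_of_map_mul_X_pow_eq (fun m hm => by rw [hL m hm, neg_mul, map_neg, mul_assoc,
        ← pow_succ']) ((h.natDegree_eq j).trans_lt hj)
    have hdeg : (X * p j).natDegree ≤ n + 1 := by
      rw [natDegree_X_mul fun h0 => h.coeff_self_ne_zero j (by rw [h0, coeff_zero]), h.natDegree_eq]
      omega
    rw [mul_comm, hshift, neg_mul, map_neg, mul_assoc, h.map_mul_eq_coeff_div hdeg, coeff_X_mul]
  have hsum := h.eq_sum_of_degree_lt (n := n + 1 + 1) (q := q)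
    ((natDegree_le_iff_degree_le.1 hq).trans_lt (by exact_mod_cast (n + 1).lt_succ_self))
  rw [Finset.sum_range_succ, Finset.sum_range_succ, h.map_mul_eq_coeff_div hq,
    hcoeff n n.lt_succ_self, Finset.sum_eq_zero fun j hj => by
      have hj := Finset.mem_range.1 hj
      rw [hcoeff j (hj.trans n.lt_succ_self), h.coeff_eq_zero_of_lt hj, zero_div, neg_zero,
        zero_smul]] at hsum
  conv_lhs => rw [hsum]
  module

end IsOrthonormalFor

/-! ### The Euler operator on a family of orthonormal polynomials -/

/-- The polynomial `(t ∂_t - x ∂_x) P_n` at the parameter `t`, for a family with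
`natDegree (P s n) ≤ n`. -/
noncomputable def eulerPoly (T : Set ℝ) (P : ℝ → ℕ → ℝ[X]) (n : ℕ) (t : ℝ) : ℝ[X] :=
  ∑ k ∈ Finset.range (n + 1),
    monomial k (t * derivWithin (fun s => (P s n).coeff k) T t - k * (P t n).coeff k)

section EulerPoly

variable {T : Set ℝ} {P : ℝ → ℕ → ℝ[X]} {n : ℕ} {t : ℝ}

lemma coeff_eulerPoly {k : ℕ} (hk : k ≤ n) : (eulerPoly T P n t).coeff k =
    t * derivWithin (fun s => (P s n).coeff k) T t - k * (P t n).coeff k := by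
  simp only [eulerPoly, finsetSum_coeff, coeff_monomial, Finset.sum_ite_eq', Finset.mem_range,
    if_pos (Nat.lt_succ_of_le hk)]

lemma natDegree_eulerPoly_le : (eulerPoly T P n t).natDegree ≤ n :=
  natDegree_sum_le_of_forall_le _ _ fun _ hk =>
    (natDegree_monomial_le _).trans (Nat.lt_succ_iff.1 (Finset.mem_range.1 hk))

lemma mul_eval_derivative {R : Type*} [CommSemiring R] {q : R[X]} {N : ℕ}
    (hq : q.natDegree ≤ N) (x : R) :
    x * (derivative q).eval x = ∑ k ∈ Finset.range (N + 1), k * q.coeff k * x ^ k := by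
  conv_lhs => rw [q.as_sum_range' _ (Nat.lt_succ_of_le hq)]
  rw [derivative_sum, eval_finsetSum, Finset.mul_sum]
  refine Finset.sum_congr rfl fun k _ => ?_
  rcases k with _ | k
  · simp
  · rw [derivative_monomial, eval_monomial, Nat.add_sub_cancel]
    ring

lemma eulerOp_eq_eval (hdeg : ∀ s ∈ T, (P s n).natDegree ≤ n) (ht : t ∈ T)
    (hcoeff : ∀ k, EulerDifferentiableWithinAt (fun s => (P s n).coeff k) T t) (x : ℝ) :
    eulerOp T P n t x = (eulerPoly T P n t).eval x := by
  have heval : ∀ s ∈ T, (P s n).eval x =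
      ∑ k ∈ Finset.range (n + 1), (P s n).coeff k * x ^ k := fun s hs =>
    eval_eq_sum_range' (Nat.lt_succ_of_le (hdeg s hs)) x
  rw [eulerOp, derivWithin_congr heval (heval t ht), mul_eval_derivative (hdeg t ht),
    EulerDifferentiableWithinAt.mul_derivWithin_sum fun k _ => (hcoeff k).mul (.const _),
    ← Finset.sum_sub_distrib, eulerPoly, eval_finsetSum]
  refine Finset.sum_congr rfl fun k _ => ?_
  rw [(hcoeff k).mul_derivWithin_mul (.const _), derivWithin_fun_const, eval_monomial]
  simp only [Pi.zero_apply]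
  ring

end EulerPoly

section MomentFamily

variable {μ : ℕ → ℝ → ℝ} {T : Set ℝ} {t : ℝ} {P : ℝ → ℕ → ℝ[X]}

lemma EulerDifferentiableWithinAt.momentFunctional_mul_X_pow {q : ℝ → ℝ[X]} {N : ℕ}
    (hμ : ∀ k, EulerDifferentiableWithinAt (μ k) T t) (ht : t ∈ T)
    (hdeg : ∀ s ∈ T, (q s).natDegree ≤ N)
    (hcoeff : ∀ k, EulerDifferentiableWithinAt (fun s => (q s).coeff k) T t) (m : ℕ) :
    EulerDifferentiableWithinAt
      (fun s => momentFunctional (fun k => μ k s) (q s * X ^ m)) T t :=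
  EulerDifferentiableWithinAt.congr (.sum fun k _ => (hcoeff k).mul (hμ (k + m)))
    (fun s hs => PrudnikovLaguerre.momentFunctional_mul_X_pow _ (hdeg s hs) m) ht

lemma mul_derivWithin_momentFunctional_mul_X_pow {α : ℝ} {n : ℕ}
    (hμ : ∀ k, EulerDifferentiableWithinAt (μ k) T t)
    (hμ' : ∀ k : ℕ, t * derivWithin (μ k) T t = μ (k + 1) t - (α + k + 1) * μ k t) (ht : t ∈ T)
    (hdeg : ∀ s ∈ T, (P s n).natDegree ≤ n)
    (hcoeff : ∀ k, EulerDifferentiableWithinAt (fun s => (P s n).coeff k) T t) (m : ℕ) :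
    t * derivWithin (fun s => momentFunctional (fun k => μ k s) (P s n * X ^ m)) T t =
      momentFunctional (fun k => μ k t) (eulerPoly T P n t * X ^ m) +
        momentFunctional (fun k => μ k t) (P t n * X ^ (m + 1)) -
        (α + m + 1) * momentFunctional (fun k => μ k t) (P t n * X ^ m) := by
  have hL : ∀ s ∈ T, momentFunctional (fun k => μ k s) (P s n * X ^ m) =
      ∑ k ∈ Finset.range (n + 1), (P s n).coeff k * μ (k + m) s := fun s hs =>
    momentFunctional_mul_X_pow _ (hdeg s hs) m
  rw [derivWithin_congr hL (hL t ht),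
    EulerDifferentiableWithinAt.mul_derivWithin_sum fun k _ => (hcoeff k).mul (hμ (k + m)),
    hL t ht, momentFunctional_mul_X_pow _ natDegree_eulerPoly_le,
    momentFunctional_mul_X_pow _ (hdeg t ht), Finset.mul_sum, ← Finset.sum_add_distrib,
    ← Finset.sum_sub_distrib]
  refine Finset.sum_congr rfl fun k hk => ?_
  rw [(hcoeff k).mul_derivWithin_mul (hμ (k + m)), hμ' (k + m),
    coeff_eulerPoly (Nat.lt_succ_iff.1 (Finset.mem_range.1 hk)), ← add_assoc k m 1]
  push_cast
  ring

lemma eulerDifferentiableWithinAt_of_inv_sq {f : ℝ → ℝ} (ht : t ∈ T)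
    (hsign : ∀ s ∈ T, 0 < f t * f s)
    (hf : EulerDifferentiableWithinAt (fun s => (f s ^ 2)⁻¹) T t) :
    EulerDifferentiableWithinAt f T t := by
  have h0 : f t ≠ 0 := left_ne_zero_of_mul (hsign t ht).ne'
  refine EulerDifferentiableWithinAt.congr ((EulerDifferentiableWithinAt.const
    (SignType.sign (f t) : ℝ)).mul ((hf.inv (by positivity)).sqrt (by positivity)))
    (fun s hs => ?_) ht
  rw [inv_inv, Real.sqrt_sq_eq_abs]
  rcases pos_and_pos_or_neg_and_neg_of_mul_pos (hsign s hs) with ⟨ht, hs⟩ | ⟨ht, hs⟩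
  · simp [sign_pos ht, abs_of_pos hs]
  · simp [sign_neg ht, abs_of_neg hs]

variable (hP : ∀ s ∈ T, IsOrthonormalFor (momentFunctional fun k => μ k s) (P s)) (ht : t ∈ T)
  (hμ : ∀ k, EulerDifferentiableWithinAt (μ k) T t)
include hP ht hμ

lemma eulerDifferentiableWithinAt_coeff
    (hsign : ∀ n, ∀ s ∈ T, 0 < (P t n).coeff n * (P s n).coeff n) (n k : ℕ) :
    EulerDifferentiableWithinAt (fun s => (P s n).coeff k) T t := by
  induction n using Nat.strong_induction_on generalizing k with
  | _ n ih =>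
  have hmoment : ∀ j ∈ Finset.range n, EulerDifferentiableWithinAt
      (fun s => momentFunctional (fun k => μ k s) (P s j * X ^ n)) T t := fun j hj =>
    .momentFunctional_mul_X_pow hμ ht (fun s hs => ((hP s hs).natDegree_eq j).le)
      (ih j (Finset.mem_range.1 hj)) n
  have hlead : EulerDifferentiableWithinAt (fun s => (P s n).coeff n) T t := by
    refine eulerDifferentiableWithinAt_of_inv_sq ht (hsign n) (EulerDifferentiableWithinAt.congr
      ((hμ (n + n)).sub (.sum fun j hj => (hmoment j hj).mul (hmoment j hj))) (fun s hs => ?_) ht)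
    rw [(hP s hs).inv_sq_coeff_self_eq n, momentFunctional_X_pow]
    simp only [sq]
  refine EulerDifferentiableWithinAt.congr (hlead.mul ((EulerDifferentiableWithinAt.const
    ((X ^ n : ℝ[X]).coeff k)).sub (.sum fun j hj =>
      (hmoment j hj).mul (ih j (Finset.mem_range.1 hj) k)))) (fun s hs => ?_) ht
  conv_lhs => rw [(hP s hs).eq_gramSchmidt n]
  simp only [coeff_smul, coeff_sub, finsetSum_coeff, smul_eq_mul]

variable {α : ℝ}
  (hμ' : ∀ k : ℕ, t * derivWithin (μ k) T t = μ (k + 1) t - (α + k + 1) * μ k t)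
  (hcoeff : ∀ n k, EulerDifferentiableWithinAt (fun s => (P s n).coeff k) T t)
include hμ' hcoeff

lemma momentFunctional_eulerPoly_mul_X_pow {n m : ℕ} (hm : m < n) :
    momentFunctional (fun k => μ k t) (eulerPoly T P n t * X ^ m) =
      -momentFunctional (fun k => μ k t) (P t n * X ^ (m + 1)) := by
  have hzero : ∀ s ∈ T, momentFunctional (fun k => μ k s) (P s n * X ^ m) = 0 := fun s hs =>
    (hP s hs).map_mul_X_pow_of_lt hm
  have hderiv := mul_derivWithin_momentFunctional_mul_X_pow hμ hμ' ht
    (fun s hs => ((hP s hs).natDegree_eq n).le) (hcoeff n) m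
  rw [derivWithin_congr hzero (hzero t ht), derivWithin_fun_const, hzero t ht, Pi.zero_apply,
    mul_zero, mul_zero, sub_zero] at hderiv
  exact eq_neg_of_add_eq_zero_left hderiv.symm

lemma eulerPoly_eq (n : ℕ) : eulerPoly T P n t =
    (t / aCoeff (P t) n * derivWithin (fun s => aCoeff (P s) n) T t - n) • P t n -
      recA (P t) n • P t (n - 1) := by
  have ha := (hP t ht).coeff_self_ne_zero n
  have htop : (eulerPoly T P n t).coeff n / (P t n).coeff n =
      t / aCoeff (P t) n * derivWithin (fun s => aCoeff (P s) n) T t - n := by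
    rw [coeff_eulerPoly le_rfl, sub_div, mul_div_cancel_right₀ _ ha, mul_div_right_comm]
    rfl
  rw [← htop]
  rcases n with _ | n
  · rw [recA, zero_smul, sub_zero]
    refine Polynomial.ext fun k => ?_
    rw [eq_C_of_natDegree_le_zero (natDegree_eulerPoly_le (n := 0)),
      eq_C_of_natDegree_le_zero ((hP t ht).natDegree_eq 0).le, coeff_C_zero, coeff_C_zero,
      smul_C, smul_eq_mul, div_mul_cancel₀ _ ha]
  · exact (hP t ht).eq_add_of_map_mul_X_pow_succ natDegree_eulerPoly_le fun m hm =>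
      momentFunctional_eulerPoly_mul_X_pow hP ht hμ hμ' hcoeff hm

lemma hasDerivWithinAt_mul_bCoeff_div_aCoeff (n : ℕ) :
    HasDerivWithinAt (fun s => s * bCoeff (P s) n / aCoeff (P s) n) (-recA (P t) n ^ 2) T t := by
  rcases n with _ | n
  · simpa [bCoeff, recA] using hasDerivWithinAt_const t T (0 : ℝ)
  have ha : (P t (n + 1)).coeff (n + 1) ≠ 0 := (hP t ht).coeff_self_ne_zero (n + 1)
  have hsub := congrArg (coeff · n) (eulerPoly_eq hP ht hμ hμ' hcoeff (n + 1))
  simp only [coeff_sub, coeff_smul, smul_eq_mul, coeff_eulerPoly n.le_succ,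
    Nat.add_sub_cancel, aCoeff, recA] at hsub
  have hquot := (hcoeff (n + 1) n).div (hcoeff (n + 1) (n + 1)) ha
  simp only [mul_div_assoc, bCoeff, aCoeff, recA]
  refine hquot.hasDerivWithinAt_id_mul.congr_deriv ?_
  rw [(hcoeff (n + 1) n).mul_derivWithin_div (hcoeff (n + 1) (n + 1)) ha]
  push_cast at hsub
  field_simp at hsub ⊢
  linarith

lemma hasDerivWithinAt_mul_recB (n : ℕ) :
    HasDerivWithinAt (fun s => s * recB (P s) n) (recA (P t) (n + 1) ^ 2 - recA (P t) n ^ 2)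
      T t := by
  have hb := hasDerivWithinAt_mul_bCoeff_div_aCoeff hP ht hμ hμ' hcoeff
  refine (((hb n).fun_sub (hb (n + 1))).congr_of_mem (fun s _ => ?_) ht).congr_deriv (by ring)
  rw [recB, mul_sub, mul_div_assoc, mul_div_assoc]

lemma eulerOp_sub_add_eq_zero (n : ℕ) (x : ℝ) :
    eulerOp T P n t x -
        (t / aCoeff (P t) n * derivWithin (fun s => aCoeff (P s) n) T t - n) * (P t n).eval x +
      recA (P t) n * (P t (n - 1)).eval x = 0 := by
  rw [eulerOp_eq_eval (fun s hs => ((hP s hs).natDegree_eq n).le) ht (hcoeff n),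
    eulerPoly_eq hP ht hμ hμ' hcoeff, eval_sub, eval_smul, eval_smul, smul_eq_mul, smul_eq_mul]
  ring

lemma isQuasiOrthogonalSeq_eulerOp {w : ℝ → ℝ}
    (hw : ∀ k : ℕ, IntegrableOn (fun x => x ^ k * w x) (Ioi 0))
    (hwμ : ∀ k : ℕ, ∫ x in Ioi (0 : ℝ), x ^ k * w x = μ k t) :
    IsQuasiOrthogonalSeq w fun n x => eulerOp T P n t x := by
  have heval : ∀ n x, eulerOp T P n t x = (eulerPoly T P n t).eval x := fun n =>
    eulerOp_eq_eval (fun s hs => ((hP s hs).natDegree_eq n).le) ht (hcoeff n)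
  have hint : ∀ n m, m < n → ∫ x in Ioi (0 : ℝ), eulerOp T P n t x * x ^ m * w x =
      -momentFunctional (fun k => μ k t) (P t n * X ^ (m + 1)) := by
    intro n m hmn
    have h := setIntegral_eval_mul_eq_momentFunctional hw (eulerPoly T P n t * X ^ m)
    simp only [eval_mul, eval_pow, eval_X, ← heval, hwμ] at h
    rw [h, momentFunctional_eulerPoly_mul_X_pow hP ht hμ hμ' hcoeff hmn]
  refine fun n => ⟨⟨_, natDegree_eulerPoly_le, heval n⟩, fun m hmn => ?_, fun hn => ?_⟩
  · rw [hint n m (by omega), (hP t ht).map_mul_X_pow_of_lt (by omega), neg_zero]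
  · rw [hint n (n - 1) (by omega), Nat.sub_add_cancel hn, (hP t ht).map_mul_X_pow_self]
    exact neg_ne_zero.2 (inv_ne_zero ((hP t ht).coeff_self_ne_zero n))

end MomentFamily

/-! ### The Euler operator for the weights `w_t` -/

section Weight

variable {α ν t : ℝ}

lemma uniqueDiffWithinAt_params (h0 : 0 < t) (ht : t ≤ 1) :
    UniqueDiffWithinAt ℝ (params ν) t :=
  (uniqueDiffOn_Ioc 0 1 t ⟨h0, ht⟩).mono Ioc_subset_params

lemma eulerDifferentiableWithinAt_mass (hα : -1 < α) (hαν : -1 < α + ν) (ht : t ∈ params ν) :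
    EulerDifferentiableWithinAt (mass α ν) (params ν) t := by
  rcases ht.1.eq_or_lt with rfl | h0
  · exact ⟨continuousWithinAt_mass_zero hα ht, fun h => absurd rfl h⟩
  · have hderiv := hasDerivWithinAt_mass hα hαν h0 ht.2.1
    exact ⟨hderiv.continuousWithinAt, fun _ => hderiv.differentiableWithinAt⟩

lemma mul_derivWithin_mass (hα : -1 < α) (hαν : -1 < α + ν) (ht : t ∈ params ν) :
    t * derivWithin (mass α ν) (params ν) t = mass (α + 1) ν t - (α + 1) * mass α ν t := by
  rcases ht.1.eq_or_lt with rfl | h0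
  · rw [zero_mul, mass_add_one_zero hα ht, sub_self]
  · rw [(hasDerivWithinAt_mass hα hαν h0 ht.2.1).derivWithin (uniqueDiffWithinAt_params h0 ht.2.1),
      mul_div_cancel₀ _ h0.ne']

end Weight

end PrudnikovLaguerre

open PrudnikovLaguerre in
theorem mainTheorem11_general (α ν : ℝ) (hα : -1 < α) (hαν : -1 < α + ν) (P : ℝ → ℕ → ℝ[X])
    (hP : ∀ t ∈ params ν, IsOrthonormalSeq (weight α ν (1 - t) t) (P t))
    (hsign : ∀ n, ∀ s ∈ params ν, ∀ t ∈ params ν, 0 < aCoeff (P s) n * aCoeff (P t) n) :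
    (∀ n k, DifferentiableOn ℝ (fun t => (P t n).coeff k) (Ioc 0 1)) ∧
    ∀ t ∈ params ν,
      (∀ n x, eulerOp (params ν) P n t x
          - (t / aCoeff (P t) n * derivWithin (fun s => aCoeff (P s) n) (params ν) t - n)
              * (P t n).eval x
          + recA (P t) n * (P t (n - 1)).eval x = 0) ∧
      (∀ n, HasDerivWithinAt (fun s => s * bCoeff (P s) n / aCoeff (P s) n)
        (-(recA (P t) n) ^ 2) (params ν) t) ∧
      (∀ n, HasDerivWithinAt (fun s => s * recB (P s) n)
        ((recA (P t) (n + 1)) ^ 2 - (recA (P t) n) ^ 2) (params ν) t) ∧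
      IsQuasiOrthogonalSeq (weight α ν (1 - t) t) (fun n x => eulerOp (params ν) P n t x) := by
  have hk : ∀ k : ℕ, -1 < α + k ∧ -1 < α + k + ν := fun k => by
    have : (0 : ℝ) ≤ k := k.cast_nonneg
    constructor <;> linarith
  have hw := fun t ht => integrableOn_pow_mul_weight (t := t) hα hαν ht
  have hO : ∀ t ∈ params ν, IsOrthonormalFor (momentFunctional fun k => mass (α + k) ν t) (P t) :=
    fun t ht => by
      simpa only [setIntegral_pow_mul_weight] using
        (hP t ht).isOrthonormalFor (hw t ht)
  have hμ : ∀ t ∈ params ν, ∀ k : ℕ, EulerDifferentiableWithinAt (mass (α + k) ν) (params ν) t :=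
    fun t ht k => eulerDifferentiableWithinAt_mass (hk k).1 (hk k).2 ht
  have hcoeff := fun t ht => eulerDifferentiableWithinAt_coeff hO ht (hμ t ht)
    fun n s hs => hsign n t ht s hs
  refine ⟨fun n k t ht => ((hcoeff t (Ioc_subset_params ht) n k).2 ht.1.ne').mono
    Ioc_subset_params, fun t ht => ?_⟩
  have hμ' : ∀ k : ℕ, t * derivWithin (mass (α + k) ν) (params ν) t =
      mass (α + (k + 1 : ℕ)) ν t - (α + k + 1) * mass (α + k) ν t := fun k => by
    rw [mul_derivWithin_mass (hk k).1 (hk k).2 ht, Nat.cast_succ, add_assoc α]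
  exact ⟨eulerOp_sub_add_eq_zero hO ht (hμ t ht) hμ' (hcoeff t ht),
    hasDerivWithinAt_mul_bCoeff_div_aCoeff hO ht (hμ t ht) hμ' (hcoeff t ht),
    hasDerivWithinAt_mul_recB hO ht (hμ t ht) hμ' (hcoeff t ht),
    isQuasiOrthogonalSeq_eulerOp hO ht (hμ t ht) hμ' (hcoeff t ht) (hw t ht)
      fun k => setIntegral_pow_mul_weight k⟩

/-- In the equation for `P t n` the last term is `0` for `n = 0`, because `recA _ 0 = 0`. -/
theorem mainTheorem11 (α ν : ℝ) (hα : -1 < α) (hν : 0 ≤ ν) (P : ℝ → ℕ → ℝ[X])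
    (hP : ∀ t ∈ PrudnikovLaguerre.params ν,
      PrudnikovLaguerre.IsOrthonormalSeq (PrudnikovLaguerre.weight α ν (1 - t) t) (P t))
    (hsign : ∀ n, ∀ s ∈ PrudnikovLaguerre.params ν, ∀ t ∈ PrudnikovLaguerre.params ν,
      0 < PrudnikovLaguerre.aCoeff (P s) n * PrudnikovLaguerre.aCoeff (P t) n) :
    (∀ n k, DifferentiableOn ℝ (fun t => (P t n).coeff k) (Set.Ioc 0 1)) ∧
    ∀ t ∈ PrudnikovLaguerre.params ν,
      (∀ n x,
        PrudnikovLaguerre.eulerOp (PrudnikovLaguerre.params ν) P n t x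
          - (t / PrudnikovLaguerre.aCoeff (P t) n
              * derivWithin (fun s => PrudnikovLaguerre.aCoeff (P s) n)
                  (PrudnikovLaguerre.params ν) t - n) * (P t n).eval x
          + PrudnikovLaguerre.recA (P t) n * (P t (n - 1)).eval x = 0) ∧
      (∀ n, HasDerivWithinAt
        (fun s => s * PrudnikovLaguerre.bCoeff (P s) n / PrudnikovLaguerre.aCoeff (P s) n)
        (-(PrudnikovLaguerre.recA (P t) n) ^ 2) (PrudnikovLaguerre.params ν) t) ∧
      (∀ n, HasDerivWithinAt (fun s => s * PrudnikovLaguerre.recB (P s) n)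
        ((PrudnikovLaguerre.recA (P t) (n + 1)) ^ 2 - (PrudnikovLaguerre.recA (P t) n) ^ 2)
        (PrudnikovLaguerre.params ν) t) ∧
      PrudnikovLaguerre.IsQuasiOrthogonalSeq (PrudnikovLaguerre.weight α ν (1 - t) t)
        (fun n x => PrudnikovLaguerre.eulerOp (PrudnikovLaguerre.params ν) P n t x) :=
  mainTheorem11_general α ν hα (by linarith) P hP hsign
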